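/- Call a finite word closed if it has length at most $1$, or if its longest border (proper prefix that is also a suffix) occurs in it exactly twice. An infinite word $w$ is infinite closed-rich if there is a constant $C>0$ such that, for every $n\in\mathbb{N}$, every factor of $w$ of length $n$ contains at least $Cn^2$ distinct closed factors. A Sturmian word is an infinite word $w=w_0w_1w_2\cdots$ over $\{0,1\}$ with exactly $n+1$ distinct factors of each length $n\ge 1$. Let $w$ be a Sturmian word. Then the frequency of the letter $1$ in $w$, $$\alpha=\lim_{n\to\infty}\frac{\#\{0\le i<n : w_i=1\}}{n},$$ called the slope of $w$, exists and is irrational. Let $\alpha=[m_0;m_1,m_2,\dots]$ be its regular continued fraction expansion. Then $w$ is infinite closed-rich if and only if the sequence of partial quotients $(m_i)_{i\ge1}$ is bounded. -/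

import Mathlib

/-! Finite words are lists; infinite words are sequences `ℕ → A`. -/

namespace Words

variable {A : Type*}

/-- `v` is a border of the finite word `u`: a proper prefix of `u` that is also a suffix of `u`. -/
def IsBorder (v u : List A) : Prop :=
  v.length < u.length ∧ v <+: u ∧ v <:+ u

/-- The set of positions at which the word `v` occurs in the finite word `u`. -/
def occurrences (v u : List A) : Set ℕ :=
  {i | i ≤ u.length ∧ v <+: u.drop i}

/-- A finite word is closed if it is empty or a letter, or if its longest border occurs in it
exactly twice. -/
def IsClosedWord (u : List A) : Prop :=
  u.length ≤ 1 ∨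
    ∃ v, IsBorder v u ∧ (∀ v', IsBorder v' u → v'.length ≤ v.length) ∧
      (occurrences v u).ncard = 2

/-- The number of distinct closed factors of a finite word (the empty word is counted). -/
noncomputable def numClosedFactors (u : List A) : ℕ :=
  {v : List A | v <:+: u ∧ IsClosedWord v}.ncard

/-- The block `w i, w (i + 1), …, w (i + n - 1)` of an infinite word. -/
def block (w : ℕ → A) (i n : ℕ) : List A :=
  List.ofFn fun k : Fin n => w (i + k)

/-- The set of factors of length `n` of an infinite word. -/
def factorsOfLength (w : ℕ → A) (n : ℕ) : Set (List A) :=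
  {u | ∃ i, u = block w i n}

/-- An infinite word is infinite closed-rich if for some constant `C > 0` and all `n`, each of its
factors of length `n` contains at least `C * n ^ 2` distinct closed factors. -/
def IsInfiniteClosedRich (w : ℕ → A) : Prop :=
  ∃ C : ℝ, 0 < C ∧ ∀ n : ℕ, ∀ u ∈ factorsOfLength w n,
    C * (n : ℝ) ^ 2 ≤ (numClosedFactors u : ℝ)

/-- A Sturmian word: a binary infinite word with exactly `n + 1` factors of each length `n ≥ 1`. -/
def IsSturmian (w : ℕ → Fin 2) : Prop :=
  ∀ n : ℕ, 1 ≤ n → (factorsOfLength w n).ncard = n + 1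

/-- `α` is the slope of the binary infinite word `w`: the frequency of the letter `1`, that is,
the limit of the proportion of `1`s in the prefix of length `n` as `n` tends to infinity. -/
def HasSlope (w : ℕ → Fin 2) (α : ℝ) : Prop :=
  Filter.Tendsto (fun n : ℕ => ((block w 0 n).count 1 : ℝ) / (n : ℝ)) Filter.atTop (nhds α)

/-- For the regular continued fraction `α = [m₀; m₁, m₂, …]`, the sequence of partial quotients
`m₁, m₂, …` is bounded (these are positive, so only an upper bound is needed). The entry of
`partDens` with index `i` is `m_{i+1}`. -/
def BoundedPartialQuotients (α : ℝ) : Prop :=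
  ∃ M : ℝ, ∀ (i : ℕ) (m : ℝ), (GenContFract.of α).partDens.get? i = some m → m ≤ M

end Words

/-! Write `height w n` for the number of letters `1` among the first `n` letters of `w`.

**Slope.** A Sturmian word has a single right special factor of each length, and this factor starts
in every window of a suitable length (`IsSturmian.exists_isRightSpecialAt_mem`), because otherwise
the word would be eventually periodic. A shortest violation of balance would be a pair of factors
`0p0`, `1p1` with a palindrome `p`, which would make both `0p` and `1p` right special; hence `w` is
balanced (`IsSturmian.height_sub_le`). Fekete's lemma yields the slope `α`, and balance gives
`|height w (i + n) - height w i - n * α| ≤ 1`. Consequently blocks of length `q` contain, up to a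
proportion `|q * α - p|` of the positions, exactly `p` letters `1`
(`IsSturmian.card_height_sub_ne_le`); for a rational slope `p / q` this would make the word
eventually periodic.

**Diophantine side.** For irrational `α` the partial quotients are bounded if and only if
`q * |q * α - p|` is bounded away from zero
(`isBadlyApproximable_iff_boundedPartialQuotients`); one direction uses Legendre's theorem.

**Rich implies badly approximable.** If `q * |q * α - p|` is small, there is a long run of positions
at which the blocks of length `q` have the same number of letters `1`, that is, a factor of period
`q` and of length `n = (M + 1) * q` with `M` large. It has at most `q * (n + 1)` factors, closed or
not, which is a small multiple of `n ^ 2`.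

**Badly approximable implies rich.** The discrepancy `height w n - n * α` ranges over an interval of
length one, and by Dirichlet's theorem its values over a window of `O(l)` positions come closer to
both ends of this interval than `|q * α - p|` for any `q ≤ l`. So no window of that size has a
period `q ≤ l`, and a counting argument of Morse-Hedlund type
(`IsSturmian.exists_period_of_block_ne`) shows that all factors of length `l` occur in it
(`IsSturmian.exists_linear_recurrence`). In a block of length `n`, each factor of length `l ≤ c * n`
thus occurs twice, and two consecutive occurrences span a closed factor with this factor as its
longest border. Distinct borders give distinct closed factors, and there are quadratically many
of them.
-/

open Filter Topology

namespace Words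

/-! ### Blocks and right special factors -/

section Blocks

variable {A : Type*} (w : ℕ → A)

@[simp]
theorem length_block (i n : ℕ) : (block w i n).length = n := by
  simp [block]

theorem block_eq_block_iff {i j n : ℕ} :
    block w i n = block w j n ↔ ∀ k < n, w (i + k) = w (j + k) := by
  rw [block, block, List.ofFn_inj, funext_iff, Fin.forall_iff]

theorem take_block {i m n : ℕ} (h : m ≤ n) : (block w i n).take m = block w i m := by
  apply List.ext_getElem <;> simp [block, h]

theorem drop_block (i m n : ℕ) : (block w i n).drop m = block w (i + m) (n - m) := by
  apply List.ext_getElem <;> simp [block, add_assoc]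

theorem block_succ_eq_iff {i j n : ℕ} :
    block w i (n + 1) = block w j (n + 1) ↔ block w i n = block w j n ∧ w (i + n) = w (j + n) := by
  simp only [block_eq_block_iff, Nat.lt_succ_iff_lt_or_eq]
  grind

theorem block_eq_of_le {i j m n : ℕ} (h : block w i n = block w j n) (hmn : m ≤ n) :
    block w i m = block w j m := by
  rw [block_eq_block_iff] at *
  exact fun k hk => h k (hk.trans_le hmn)

theorem block_add_one_eq {i j n : ℕ} (h : block w i (n + 1) = block w j (n + 1)) :
    block w (i + 1) n = block w (j + 1) n := by
  rw [block_eq_block_iff] at *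
  intro k hk
  have := h (k + 1) (by omega)
  rwa [add_assoc, add_assoc, add_comm 1 k]

theorem block_mem_factorsOfLength (i n : ℕ) : block w i n ∈ factorsOfLength w n := ⟨i, rfl⟩

/-- The factor of length `n` at position `i` is right special: another of its occurrences is
followed by a different letter. -/
def IsRightSpecialAt (i n : ℕ) : Prop :=
  ∃ j, block w j n = block w i n ∧ w (j + n) ≠ w (i + n)

variable {w}

theorem IsRightSpecialAt.congr {i j n : ℕ} (h : IsRightSpecialAt w i n)
    (hij : block w j n = block w i n) : IsRightSpecialAt w j n := by
  obtain ⟨k, hk, hne⟩ := h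
  by_cases hj : w (j + n) = w (i + n)
  · exact ⟨k, hk.trans hij.symm, hj ▸ hne⟩
  · exact ⟨i, hij.symm, fun h => hj h.symm⟩

theorem IsRightSpecialAt.suffix {i m n : ℕ} (h : IsRightSpecialAt w i (m + n)) :
    IsRightSpecialAt w (i + m) n := by
  obtain ⟨j, hj, hne⟩ := h
  refine ⟨j + m, ?_, by rwa [add_assoc, add_assoc]⟩
  rw [block_eq_block_iff] at *
  intro k hk
  rw [add_assoc, add_assoc]
  exact hj (m + k) (by omega)

end Blocks

namespace IsSturmian

variable {w : ℕ → Fin 2} (hw : IsSturmian w)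
include hw

theorem finite_factorsOfLength (n : ℕ) : (factorsOfLength w n).Finite := by
  rcases Nat.eq_zero_or_pos n with rfl | hn
  · refine (Set.finite_singleton []).subset ?_
    rintro _ ⟨i, rfl⟩
    simp [block]
  · exact Set.finite_of_ncard_pos (by rw [hw n hn]; omega)

/-- A Sturmian word has at most one right special factor of each length, since the number of
factors grows by one from each length to the next. -/
theorem block_eq_of_isRightSpecialAt {i j n : ℕ} (hi : IsRightSpecialAt w i n)
    (hj : IsRightSpecialAt w j n) : block w i n = block w j n := by
  rcases Nat.eq_zero_or_pos n with rfl | hn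
  · simp [block]
  by_contra hne
  obtain ⟨i', hi', hwi⟩ := hi
  obtain ⟨j', hj', hwj⟩ := hj
  have hfin := hw.finite_factorsOfLength (n + 1)
  -- dropping one extension of each of the two right special factors loses no factor of length `n`
  set R : Set (List (Fin 2)) := {block w i (n + 1), block w j (n + 1)} with hR
  have hRsub : R ⊆ factorsOfLength w (n + 1) := by
    rintro _ (rfl | rfl) <;> exact block_mem_factorsOfLength ..
  have hRcard : R.ncard = 2 := by
    refine Set.ncard_pair fun h => hne (block_eq_of_le w h n.le_succ)
  have hcard : (factorsOfLength w (n + 1) \ R).ncard = n := by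
    rw [Set.ncard_sdiff hRsub (hfin.subset hRsub), hRcard, hw _ (by omega)]
    omega
  have hsub : factorsOfLength w n ⊆ List.take n '' (factorsOfLength w (n + 1) \ R) := by
    rintro _ ⟨k, rfl⟩
    have key : ∀ l, block w l n = block w k n → block w l (n + 1) ∉ R →
        block w k n ∈ List.take n '' (factorsOfLength w (n + 1) \ R) := fun l hl hlR =>
      ⟨_, ⟨block_mem_factorsOfLength .., hlR⟩, by rw [take_block w n.le_succ, hl]⟩
    by_cases hk : block w k (n + 1) ∈ R
    · rcases hk with hk | hk
      · rw [block_succ_eq_iff] at hk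
        refine key i' (hi'.trans hk.1.symm) ?_
        rintro (h | h)
        · exact hwi ((block_succ_eq_iff w).1 h).2
        · exact hne (hi'.symm.trans ((block_succ_eq_iff w).1 h).1)
      · rw [Set.mem_singleton_iff, block_succ_eq_iff] at hk
        refine key j' (hj'.trans hk.1.symm) ?_
        rintro (h | h)
        · exact hne (((block_succ_eq_iff w).1 h).1.symm.trans hj')
        · exact hwj ((block_succ_eq_iff w).1 h).2
    · exact key k rfl hk
  have h1 := Set.ncard_le_ncard hsub ((hfin.subset Set.sdiff_subset).image _)
  have h2 := Set.ncard_image_le (f := List.take n) (hfin.subset (Set.sdiff_subset (t := R)))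
  rw [hw n hn] at h1
  omega

theorem not_eventually_periodic {a b : ℕ} (hab : a < b) (h : ∀ t, w (a + t) = w (b + t)) :
    False := by
  have hsub : factorsOfLength w b ⊆ (fun i => block w i b) '' Set.Iio b := by
    rintro _ ⟨k, rfl⟩
    induction k using Nat.strong_induction_on with
    | _ k ih =>
      rcases lt_or_ge k b with hk | hk
      · exact ⟨k, hk, rfl⟩
      · have : block w k b = block w (k - b + a) b := by
          rw [block_eq_block_iff]
          intro s _
          have := h (k - b + s)
          rw [show k + s = b + (k - b + s) by omega, ← this]
          congr 1; omega
        rw [this]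
        exact ih _ (by omega)
  have h1 := Set.ncard_le_ncard hsub ((Set.finite_Iio b).image _)
  have h2 := Set.ncard_image_le (f := fun i => block w i b) (Set.finite_Iio b)
  rw [hw b (by omega)] at h1
  rw [Set.ncard_eq_toFinset_card' (Set.Iio b)] at h2
  simp at h2
  omega

theorem exists_isRightSpecialAt {n : ℕ} (hn : 1 ≤ n) : ∃ i, IsRightSpecialAt w i n := by
  by_contra! hno
  have hinj : Set.InjOn (List.take n) (factorsOfLength w (n + 1)) := by
    rintro _ ⟨i, rfl⟩ _ ⟨j, rfl⟩ h
    rw [take_block w n.le_succ, take_block w n.le_succ] at h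
    refine (block_succ_eq_iff w).2 ⟨h, ?_⟩
    by_contra hne
    exact hno i ⟨j, h.symm, fun h' => hne h'.symm⟩
  have hsub : List.take n '' factorsOfLength w (n + 1) ⊆ factorsOfLength w n := by
    rintro _ ⟨_, ⟨i, rfl⟩, rfl⟩
    exact ⟨i, take_block w n.le_succ⟩
  have h := Set.ncard_le_ncard hsub (hw.finite_factorsOfLength n)
  rw [hinj.ncard_image, hw n hn, hw _ (by omega)] at h
  omega

/-- The right special factor of length `n` starts in every window of `n + 1` positions. Otherwise
two positions of the window carry the same factor, and the word returns to it forever. -/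
theorem exists_isRightSpecialAt_mem (j : ℕ) {n : ℕ} (hn : 1 ≤ n) :
    ∃ t ≤ n, IsRightSpecialAt w (j + t) n := by
  obtain ⟨i, hi⟩ := hw.exists_isRightSpecialAt hn
  by_contra! hno
  have hfin := hw.finite_factorsOfLength n
  obtain ⟨s, hs, t, ht, hst, hblock⟩ : ∃ s ∈ Finset.range (n + 1), ∃ t ∈ Finset.range (n + 1),
      s ≠ t ∧ block w (j + s) n = block w (j + t) n := by
    refine Finset.exists_ne_map_eq_of_card_lt_of_maps_to
      (t := (hfin.subset (Set.sdiff_subset (t := {block w i n}))).toFinset) ?_ ?_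
    · rw [← Set.ncard_eq_toFinset_card _ (hfin.subset Set.sdiff_subset),
        Set.ncard_sdiff_singleton_of_mem (block_mem_factorsOfLength w i n), hw n hn]
      simp
    · intro s hs
      simp only [Set.Finite.coe_toFinset]
      refine ⟨block_mem_factorsOfLength .., fun h => ?_⟩
      exact hno s (by simpa [Nat.lt_succ_iff] using hs) (hi.congr h)
  wlog hlt : s < t generalizing s t
  · exact this t ht s hs hst.symm hblock.symm (by omega)
  simp only [Finset.mem_range] at hs ht
  have key : ∀ u, block w (j + s + u) n = block w (j + t + u) n ∧
      ¬ IsRightSpecialAt w (j + s + u) n := by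
    intro u
    induction u using Nat.strong_induction_on with
    | _ u ih =>
      refine ⟨?_, ?_⟩
      · rcases u with _ | u
        · exact hblock
        · obtain ⟨h1, h2⟩ := ih u (by omega)
          apply block_add_one_eq (i := j + s + u) (j := j + t + u)
          rw [block_succ_eq_iff]
          refine ⟨h1, ?_⟩
          by_contra h
          exact h2 ⟨_, h1.symm, fun h' => h h'.symm⟩
      · rcases lt_or_ge (s + u) t with h | h
        · rw [add_assoc]
          exact hno _ (by omega)
        · obtain ⟨h1, h2⟩ := ih (s + u - t) (by omega)
          have e : j + t + (s + u - t) = j + s + u := by omega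
          rw [e] at h1
          exact fun h' => h2 (h'.congr h1)
  refine hw.not_eventually_periodic (a := j + s) (b := j + t) (by omega) fun u => ?_
  have := (block_eq_block_iff w).1 (key u).1 0 (by omega)
  simpa using this

end IsSturmian

/-! ### Balance -/

/-- The number of letters `1` among the first `n` letters of a binary word, as an integer. -/
def height (w : ℕ → Fin 2) (n : ℕ) : ℤ := ∑ k ∈ Finset.range n, ((w k : ℕ) : ℤ)

@[simp]
theorem height_zero (w : ℕ → Fin 2) : height w 0 = 0 := by
  simp [height]

theorem height_succ (w : ℕ → Fin 2) (n : ℕ) :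
    height w (n + 1) = height w n + ((w n : ℕ) : ℤ) := by
  simp [height, Finset.sum_range_succ]

theorem count_one_block (w : ℕ → Fin 2) (n : ℕ) :
    ((block w 0 n).count 1 : ℤ) = height w n := by
  induction n with
  | zero => simp [block]
  | succ n ih =>
    rw [height_succ, ← ih]
    have : block w 0 (n + 1) = block w 0 n ++ [w n] := by
      rw [block, List.ofFn_succ_last]
      simp [block]
    rw [this, List.count_append, List.count_singleton]
    generalize w n = x
    fin_cases x <;> simp

namespace IsSturmian

variable {w : ℕ → Fin 2} (hw : IsSturmian w)
include hw

/-- If `apa` and `bpb` are factors for a palindrome `p` of length `m` and letters `a ≠ b`, then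
`bp` is right special: otherwise the right special factor of length `m + 1` is some other letter
followed by `p`, and as `p` is a palindrome this word has no occurrence starting in `bpb`. -/
theorem isRightSpecialAt_of_palindrome {i j m : ℕ} (hij : w i ≠ w j)
    (heq : ∀ t, 1 ≤ t → t ≤ m → w (j + t) = w (i + t))
    (hpal : ∀ t, 1 ≤ t → t ≤ m → w (j + t) = w (j + (m + 1 - t)))
    (hi : w (i + (m + 1)) = w i) (hj : w (j + (m + 1)) = w j) :
    IsRightSpecialAt w j (m + 1) := by
  by_contra hns
  obtain ⟨t, ht, hts⟩ := hw.exists_isRightSpecialAt_mem j (n := m + 1) (by omega)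
  have hsuf : IsRightSpecialAt w (j + t + 1) m := by
    rw [add_comm m 1] at hts
    exact hts.suffix
  have hp : IsRightSpecialAt w (j + 1) m := by
    refine ⟨i + 1, ?_, ?_⟩
    · rw [block_eq_block_iff]
      intro k hk
      have := heq (1 + k) (by omega) (by omega)
      rw [add_assoc, add_assoc, this]
    · rw [add_assoc, add_assoc, add_comm 1 m, hi, hj]
      exact hij
  have hblock := hw.block_eq_of_isRightSpecialAt hsuf hp
  rw [block_eq_block_iff] at hblock
  have hne : w (j + t) ≠ w j := by
    intro h
    refine hns (hts.congr ?_)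
    rw [block_eq_block_iff]
    rintro (_ | k) hk
    · simpa using h.symm
    · have := hblock k (by omega)
      rw [show j + t + 1 + k = j + t + (k + 1) by omega,
        show j + 1 + k = j + (k + 1) by omega] at this
      exact this.symm
  have ht0 : t ≠ 0 := by
    rintro rfl
    exact hne rfl
  have htm : t ≠ m + 1 := by
    rintro rfl
    exact hne hj
  have h1 := hblock (m - t) (by omega)
  rw [show j + t + 1 + (m - t) = j + (m + 1) by omega,
    show j + 1 + (m - t) = j + (m + 1 - t) by omega, hj,
    ← hpal t (by omega) (by omega)] at h1
  exact hne h1.symm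

/-- Sturmian words are balanced: the numbers of letters `1` in two factors of the same length
differ by at most one. A pair of shortest factors violating this would be `0p0` and `1p1` with a
palindrome `p`. -/
theorem height_sub_le (i j n : ℕ) :
    (height w (j + n) - height w j) - (height w (i + n) - height w i) ≤ 1 := by
  classical
  by_contra! hcon
  have hex : ∃ n i j, 1 < (height w (j + n) - height w j) - (height w (i + n) - height w i) :=
    ⟨n, i, j, hcon⟩
  clear hcon i j n
  obtain ⟨n, ⟨i, j, hij⟩, hmin⟩ : ∃ n,
      (∃ i j, 1 < (height w (j + n) - height w j) - (height w (i + n) - height w i)) ∧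
      ∀ m < n, ∀ i j,
        (height w (j + m) - height w j) - (height w (i + m) - height w i) ≤ 1 := by
    refine ⟨Nat.find hex, Nat.find_spec hex, fun m hm => ?_⟩
    simpa using Nat.find_min hex hm
  have hx : ∀ k, 0 ≤ ((w k : ℕ) : ℤ) ∧ ((w k : ℕ) : ℤ) ≤ 1 := fun k => by
    have := (w k).isLt
    omega
  have hs := height_succ w
  have hinj : ∀ k l, ((w k : ℕ) : ℤ) = ((w l : ℕ) : ℤ) → w k = w l := fun k l h => by
    apply Fin.ext
    exact_mod_cast h
  -- prefixes of equal length, and a prefix against a suffix, have excess exactly one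
  have hg : ∀ t, 1 ≤ t → t < n →
      (height w (j + t) - height w j) - (height w (i + t) - height w i) = 1 := by
    intro t h1 h2
    have h3 := hmin t h2 i j
    have h4 := hmin (n - t) (by omega) (i + t) (j + t)
    rw [show i + t + (n - t) = i + n by omega, show j + t + (n - t) = j + n by omega] at h4
    omega
  have hk : ∀ t, 1 ≤ t → t < n →
      (height w (j + t) - height w j) - (height w (i + n) - height w (i + (n - t))) = 1 := by
    intro t h1 h2
    have h3 := hmin t h2 (i + (n - t)) j
    have h4 := hmin (n - t) (by omega) i (j + t)
    rw [show i + (n - t) + t = i + n by omega] at h3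
    rw [show j + t + (n - t) = j + n by omega] at h4
    omega
  have hn : 2 ≤ n := by
    rcases n with _ | _ | n
    · simp at hij
    · rw [zero_add, hs, hs] at hij
      have := hx i
      have := hx j
      omega
    · omega
  obtain ⟨m, rfl⟩ : ∃ m, n = m + 2 := ⟨n - 2, by omega⟩
  have hfst : ((w i : ℕ) : ℤ) = 0 ∧ ((w j : ℕ) : ℤ) = 1 := by
    have := hg 1 le_rfl (by omega)
    rw [hs, hs] at this
    have := hx i
    have := hx j
    omega
  have hlst : ((w (i + (m + 1)) : ℕ) : ℤ) = 0 ∧ ((w (j + (m + 1)) : ℕ) : ℤ) = 1 := by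
    have := hg (m + 1) (by omega) (by omega)
    rw [show j + (m + 2) = j + (m + 1) + 1 by omega, show i + (m + 2) = i + (m + 1) + 1 by omega,
      hs, hs] at hij
    have := hx (i + (m + 1))
    have := hx (j + (m + 1))
    omega
  have heq : ∀ t, 1 ≤ t → t ≤ m → w (j + t) = w (i + t) := by
    intro t h1 h2
    have h3 := hg t h1 (by omega)
    have h4 := hg (t + 1) (by omega) (by omega)
    rw [← add_assoc, ← add_assoc, hs, hs] at h4
    apply hinj
    omega
  have hpal : ∀ t, 1 ≤ t → t ≤ m → w (j + t) = w (i + (m + 1 - t)) := by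
    intro t h1 h2
    have h3 := hk t h1 (by omega)
    have h4 := hk (t + 1) (by omega) (by omega)
    rw [← add_assoc, hs, show m + 2 - (t + 1) = m + 1 - t by omega] at h4
    rw [show i + (m + 2 - t) = i + (m + 1 - t) + 1 by omega, hs] at h3
    apply hinj
    omega
  have hne : w i ≠ w j := by
    intro h
    rw [h] at hfst
    omega
  have hi := hinj (i + (m + 1)) i (hlst.1.trans hfst.1.symm)
  have hj := hinj (j + (m + 1)) j (hlst.2.trans hfst.2.symm)
  -- two right special factors of the same length coincide, but these have different first letters
  have hi' : IsRightSpecialAt w i (m + 1) :=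
    hw.isRightSpecialAt_of_palindrome hne.symm (fun t h1 h2 => (heq t h1 h2).symm)
      (fun t h1 h2 => (heq t h1 h2).symm.trans (hpal t h1 h2)) hj hi
  have hj' : IsRightSpecialAt w j (m + 1) :=
    hw.isRightSpecialAt_of_palindrome hne heq
      (fun t h1 h2 => (hpal t h1 h2).trans (heq _ (by omega) (by omega)).symm) hi hj
  have := (block_eq_block_iff w).1 (hw.block_eq_of_isRightSpecialAt hi' hj') 0 (by omega)
  exact hne (by simpa using this)

end IsSturmian

end Words

namespace Words.IsSturmian

/-! ### The slope and its discrepancy -/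

variable {w : ℕ → Fin 2} (hw : IsSturmian w)
include hw

theorem exists_tendsto_height_div :
    ∃ α : ℝ, Tendsto (fun n : ℕ => (height w n : ℝ) / n) atTop (𝓝 α) := by
  have hsub : Subadditive fun n => (height w n : ℝ) + 1 := by
    intro m n
    have h := hw.height_sub_le 0 m n
    simp only [zero_add, height_zero, sub_zero] at h
    have h' : height w (m + n) + 1 ≤ height w m + 1 + (height w n + 1) := by omega
    change (height w (m + n) : ℝ) + 1 ≤ height w m + 1 + (height w n + 1)
    exact_mod_cast h'
  have hbdd : BddBelow (Set.range fun n : ℕ => ((height w n : ℝ) + 1) / n) := by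
    refine ⟨0, ?_⟩
    rintro _ ⟨n, rfl⟩
    have h0 : (0 : ℤ) ≤ height w n := Finset.sum_nonneg fun k _ => by positivity
    have h1 : (0 : ℝ) ≤ height w n := by exact_mod_cast h0
    positivity
  refine ⟨hsub.lim, ?_⟩
  have h := (hsub.tendsto_lim hbdd).sub (tendsto_one_div_atTop_nhds_zero_nat (𝕜 := ℝ))
  rw [sub_zero] at h
  refine h.congr fun n => ?_
  ring

variable {α : ℝ} (hα : Tendsto (fun n : ℕ => (height w n : ℝ) / n) atTop (𝓝 α))
include hα

theorem abs_height_sub_sub_le (i n : ℕ) :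
    |((height w (i + n) : ℝ) - height w i) - n * α| ≤ 1 := by
  rcases Nat.eq_zero_or_pos n with rfl | hn
  · simp
  have hn' : (0 : ℝ) < n := by exact_mod_cast hn
  have hlim : Tendsto (fun k : ℕ => (height w (k * n) : ℝ) / k) atTop (𝓝 (n * α)) := by
    have h := (hα.comp (tendsto_id.atTop_mul_const' hn)).const_mul (n : ℝ)
    refine h.congr fun k => ?_
    rcases Nat.eq_zero_or_pos k with rfl | hk
    · simp
    · have hk' : (0 : ℝ) < k := by exact_mod_cast hk
      simp only [Function.comp, id]
      push_cast
      field_simp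
  have hup : ∀ k : ℕ, height w (k * n) ≤ k * (height w (i + n) - height w i + 1) := by
    intro k
    induction k with
    | zero => simp
    | succ k ih =>
      have h := hw.height_sub_le i (k * n) n
      rw [Nat.succ_mul]
      push_cast
      linarith
  have hlo : ∀ k : ℕ, k * (height w (i + n) - height w i - 1) ≤ height w (k * n) := by
    intro k
    induction k with
    | zero => simp
    | succ k ih =>
      have h := hw.height_sub_le (k * n) i n
      rw [Nat.succ_mul]
      push_cast
      linarith
  rw [abs_le]
  constructor
  · have h : (n : ℝ) * α ≤ height w (i + n) - height w i + 1 := by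
      refine le_of_tendsto hlim ((eventually_gt_atTop 0).mono fun k hk => ?_)
      have hk' : (0 : ℝ) < k := by exact_mod_cast hk
      rw [div_le_iff₀ hk', mul_comm _ (k : ℝ)]
      exact_mod_cast hup k
    linarith
  · have h : (height w (i + n) : ℝ) - height w i - 1 ≤ (n : ℝ) * α := by
      refine ge_of_tendsto hlim ((eventually_gt_atTop 0).mono fun k hk => ?_)
      have hk' : (0 : ℝ) < k := by exact_mod_cast hk
      rw [le_div_iff₀ hk', mul_comm _ (k : ℝ)]
      exact_mod_cast hlo k
    linarith

theorem abs_sum_height_sub_sub_le (q N : ℕ) :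
    |∑ i ∈ Finset.range N, ((height w (i + q) : ℝ) - height w i - q * α)| ≤ q := by
  have hcomm : ∑ i ∈ Finset.range N, ((height w (i + q) : ℝ) - height w i) =
      ∑ j ∈ Finset.range q, ((height w (j + N) : ℝ) - height w j) := by
    have h1 := Finset.sum_range_add (fun k => (height w k : ℝ)) q N
    have h2 := Finset.sum_range_add (fun k => (height w k : ℝ)) N q
    rw [add_comm N q] at h2
    simp only [Finset.sum_sub_distrib, add_comm _ q, add_comm _ N]
    linarith
  have : ∑ i ∈ Finset.range N, ((height w (i + q) : ℝ) - height w i - q * α) =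
      ∑ j ∈ Finset.range q, ((height w (j + N) : ℝ) - height w j - N * α) := by
    rw [Finset.sum_sub_distrib, hcomm, Finset.sum_sub_distrib (s := Finset.range q)]
    simp
    ring
  rw [this]
  refine (Finset.abs_sum_le_sum_abs _ _).trans ?_
  refine (Finset.sum_le_card_nsmul _ _ 1 fun j _ => ?_).trans (by simp)
  exact hw.abs_height_sub_sub_le hα j N

/-- Few blocks of length `q` have a number of letters `1` different from `p` when `p / q` is close
to the slope: by balance all deviations from `p` have the same sign, and on average they equal
`q * α - p`. -/
theorem card_height_sub_ne_le (q N : ℕ) (p : ℤ) :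
    (((Finset.range N).filter fun i => height w (i + q) - height w i ≠ p).card : ℝ) ≤
      q + N * |q * α - p| := by
  have habs : ∑ i ∈ Finset.range N, |height w (i + q) - height w i - p| =
      |∑ i ∈ Finset.range N, (height w (i + q) - height w i - p)| := by
    by_cases h : ∀ i, p ≤ height w (i + q) - height w i
    · rw [Finset.abs_sum_of_nonneg fun i _ => sub_nonneg.2 (h i)]
      exact Finset.sum_congr rfl fun i _ => abs_of_nonneg (sub_nonneg.2 (h i))
    · obtain ⟨j, hj⟩ := not_forall.1 h
      have h' : ∀ i, height w (i + q) - height w i - p ≤ 0 := fun i => by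
        have := hw.height_sub_le j i q
        omega
      rw [← abs_neg (∑ i ∈ _, _), ← Finset.sum_neg_distrib,
        Finset.abs_sum_of_nonneg fun i _ => neg_nonneg.2 (h' i)]
      exact Finset.sum_congr rfl fun i _ => abs_of_nonpos (h' i)
  have hcard : (((Finset.range N).filter fun i => height w (i + q) - height w i ≠ p).card : ℤ) ≤
      |∑ i ∈ Finset.range N, (height w (i + q) - height w i - p)| := by
    rw [← habs, Finset.card_filter]
    push_cast
    refine Finset.sum_le_sum fun i _ => ?_
    split_ifs with h
    · exact Int.one_le_abs (sub_ne_zero.2 h)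
    · exact abs_nonneg _
  have hcard' : (((Finset.range N).filter
      fun i => height w (i + q) - height w i ≠ p).card : ℝ) ≤
      |∑ i ∈ Finset.range N, ((height w (i + q) : ℝ) - height w i - p)| := by
    exact_mod_cast hcard
  refine hcard'.trans ?_
  have hsplit : ∑ i ∈ Finset.range N, ((height w (i + q) : ℝ) - height w i - p) =
      ∑ i ∈ Finset.range N, ((height w (i + q) : ℝ) - height w i - q * α) +
        N * (q * α - p) := by
    simp only [Finset.sum_sub_distrib, Finset.sum_const, Finset.card_range, nsmul_eq_mul]
    ring
  rw [hsplit]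
  refine (abs_add_le _ _).trans (add_le_add (hw.abs_sum_height_sub_sub_le hα q N) ?_)
  rw [abs_mul, Nat.abs_cast]

/-- For a rational slope `p / q` all but finitely many blocks of length `q` contain exactly `p`
letters `1`, which makes the word eventually periodic. -/
theorem irrational_slope : Irrational α := by
  rintro ⟨r, rfl⟩
  have hr : (r.den : ℝ) * r - r.num = 0 := by
    have : (r.den : ℝ) * r = r.num := by exact_mod_cast Rat.den_mul_eq_num r
    linarith
  set B : Set ℕ := {i | height w (i + r.den) - height w i ≠ r.num}
  have hB : B.Finite := by
    by_contra hinf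
    obtain ⟨t, htB, ht⟩ := Set.Infinite.exists_subset_card_eq hinf (r.den + 1)
    obtain ⟨N, hN⟩ := t.exists_nat_subset_range
    have h1 := hw.card_height_sub_ne_le hα r.den N r.num
    rw [hr, abs_zero, mul_zero, add_zero] at h1
    have h2 : t ⊆ (Finset.range N).filter fun i => height w (i + r.den) - height w i ≠ r.num :=
      fun i hi => Finset.mem_filter.2 ⟨hN hi, htB hi⟩
    have h3 := Finset.card_le_card h2
    rw [ht] at h3
    have h4 : ((r.den + 1 : ℕ) : ℝ) ≤ r.den := le_trans (by exact_mod_cast h3) h1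
    push_cast at h4
    linarith
  obtain ⟨M, hM⟩ := hB.bddAbove
  have hconst : ∀ i, M < i → height w (i + r.den) - height w i = r.num := fun i hi => by
    by_contra h
    exact absurd (hM h) (by omega)
  refine hw.not_eventually_periodic (a := M + 1) (b := M + 1 + r.den)
    (by have := r.pos; omega) fun t => ?_
  have h1 := hconst (M + 1 + t) (by omega)
  have h2 := hconst (M + 1 + t + 1) (by omega)
  rw [show M + 1 + t + 1 + r.den = M + 1 + t + r.den + 1 by omega, height_succ, height_succ] at h2
  have h3 : ((w (M + 1 + t) : ℕ) : ℤ) = ((w (M + 1 + t + r.den) : ℕ) : ℤ) := by omega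
  rw [show M + 1 + r.den + t = M + 1 + t + r.den by omega]
  apply Fin.ext
  exact_mod_cast h3

theorem exists_run_height_sub_eq {q L : ℕ} {p : ℤ} (hL : L * |q * α - p| < 1) :
    ∃ a, ∀ i, a ≤ i → i < a + L → height w (i + q) - height w i = p := by
  by_contra! hno
  choose f hf1 hf2 hf3 using hno
  have hcount : ∀ k : ℕ, (k : ℝ) ≤ q + (k * L : ℕ) * |q * α - p| := by
    intro k
    refine le_trans ?_ (hw.card_height_sub_ne_le hα q (k * L) p)
    have hle : ∀ s t : ℕ, s < t → f (s * L) < f (t * L) := fun s t hst => by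
      have h1 := hf2 (s * L)
      have h2 := hf1 (t * L)
      have h3 := Nat.mul_le_mul_right L (Nat.succ_le_of_lt hst)
      rw [Nat.succ_mul] at h3
      omega
    have := Finset.card_le_card_of_injOn (s := Finset.range k)
      (t := (Finset.range (k * L)).filter fun i => height w (i + q) - height w i ≠ p)
      (fun t => f (t * L)) (fun t ht => by
        have h1 := hf2 (t * L)
        have h3 := Nat.mul_le_mul_right L (Nat.succ_le_of_lt (Finset.mem_range.1 ht))
        rw [Nat.succ_mul] at h3
        simp only [Finset.coe_filter, Finset.mem_range, Set.mem_ofPred_eq]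
        exact ⟨by omega, hf3 _⟩) (StrictMono.injective fun s t => hle s t).injOn
    rw [Finset.card_range] at this
    exact_mod_cast this
  obtain ⟨k, hk⟩ := exists_nat_gt (q / (1 - L * |q * α - p|))
  rw [div_lt_iff₀ (by linarith)] at hk
  have := hcount k
  push_cast at this
  linarith

end Words.IsSturmian

namespace Words

/-! ### Bounded partial quotients and badly approximable numbers -/

/-- A real number is badly approximable if `q * |q * α - p|` is bounded away from zero over all
fractions `p / q`, reduced or not. -/
def IsBadlyApproximable (α : ℝ) : Prop :=
  ∃ c : ℝ, 0 < c ∧ ∀ (q : ℕ) (p : ℤ), 1 ≤ q → c ≤ q * |q * α - p|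

section ContFract

open GenContFract

variable (α : ℝ)

theorem exists_int_contsAux_of (n : ℕ) :
    ∃ a b : ℤ, (GenContFract.of α).contsAux n = ⟨(a : ℝ), (b : ℝ)⟩ := by
  induction n using Nat.strong_induction_on with
  | _ n ih =>
    match n, ih with
    | 0, _ => exact ⟨1, 0, by simp [contsAux]⟩
    | 1, _ => exact ⟨⌊α⌋, 1, by simp [contsAux, of_h_eq_floor]⟩
    | n + 2, ih =>
      obtain ⟨a₀, b₀, h₀⟩ := ih n (by omega)
      obtain ⟨a₁, b₁, h₁⟩ := ih (n + 1) (by omega)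
      rcases hs : (GenContFract.of α).s.get? n with _ | gp
      · exact ⟨a₁, b₁, by rw [contsAux_stable_step_of_terminated hs, h₁]⟩
      · obtain ⟨ha, z, hz⟩ := of_partNum_eq_one_and_exists_int_partDen_eq hs
        refine ⟨z * a₁ + a₀, z * b₁ + b₀, ?_⟩
        rw [contsAux_recurrence hs h₀ h₁, ha, hz]
        simp

variable {α}

theorem not_terminatedAt_of_irrational (hα : Irrational α) (n : ℕ) :
    ¬ (GenContFract.of α).TerminatedAt n := fun h => by
  obtain ⟨r, hr⟩ := (terminates_iff_rat α).1 ⟨n, h⟩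
  exact hα ⟨r, hr.symm⟩

theorem one_le_dens_of_irrational (hα : Irrational α) (n : ℕ) :
    1 ≤ (GenContFract.of α).dens n := by
  have h := succ_nth_fib_le_of_nth_den (v := α) (n := n)
    (Or.inr (not_terminatedAt_of_irrational hα _))
  have h1 : 1 ≤ Nat.fib (n + 1) := Nat.fib_pos.2 n.succ_pos
  exact le_trans (by exact_mod_cast h1) h

/-- Convergents are reduced: any fraction representing the `n`-th convergent has at least its
denominator. -/
theorem dens_le_of_convs_eq (hα : Irrational α) {n q : ℕ} {p : ℤ} (hq : 1 ≤ q)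
    (h : (GenContFract.of α).convs n = p / q) : (GenContFract.of α).dens n ≤ q := by
  have hB := one_le_dens_of_irrational hα n
  have hq' : (0 : ℝ) < q := by exact_mod_cast hq
  have hdet := SimpContFract.determinant (s := SimpContFract.of α) (n := n)
    (not_terminatedAt_of_irrational hα n)
  change (GenContFract.of α).nums n * (GenContFract.of α).dens (n + 1) -
    (GenContFract.of α).dens n * (GenContFract.of α).nums (n + 1) = _ at hdet
  obtain ⟨a, b, hab⟩ := exists_int_contsAux_of α (n + 2)
  have hnum : (GenContFract.of α).nums (n + 1) = a := by
    rw [num_eq_conts_a, nth_cont_eq_succ_nth_contAux, hab]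
  have hden : (GenContFract.of α).dens (n + 1) = b := by
    rw [den_eq_conts_b, nth_cont_eq_succ_nth_contAux, hab]
  rw [conv_eq_num_div_den, div_eq_div_iff (by linarith) hq'.ne'] at h
  rw [hnum, hden] at hdet
  have h1 : (GenContFract.of α).dens n * ((p * b - q * a : ℤ) : ℝ) = q * (-1) ^ (n + 1) := by
    rw [← hdet]
    push_cast
    linear_combination (-b : ℝ) * h
  have h2 : (GenContFract.of α).dens n * |((p * b - q * a : ℤ) : ℝ)| = q := by
    have := congrArg abs h1
    rwa [abs_mul, abs_mul, abs_pow, abs_neg, abs_one, one_pow, mul_one,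
      abs_of_pos (by linarith : (0 : ℝ) < (GenContFract.of α).dens n), Nat.abs_cast] at this
  have h3 : (1 : ℝ) ≤ |((p * b - q * a : ℤ) : ℝ)| := by
    have : p * b - q * a ≠ 0 := by
      intro h0
      rw [h0, Int.cast_zero, abs_zero, mul_zero] at h2
      exact hq'.ne h2
    exact_mod_cast Int.one_le_abs this
  nlinarith

theorem le_abs_sub_convs (hα : Irrational α) {M : ℝ}
    (hM : ∀ (i : ℕ) (m : ℝ), (GenContFract.of α).partDens.get? i = some m → m ≤ M) (n : ℕ) :
    1 / ((M + 2) * (GenContFract.of α).dens n ^ 2) ≤ |α - (GenContFract.of α).convs n| := by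
  have hnt := not_terminatedAt_of_irrational hα n
  obtain ⟨gp, hgp⟩ := Option.ne_none_iff_exists'.1 hnt
  obtain ⟨ifp', hifp', hb⟩ :=
    IntFractPair.exists_succ_get?_stream_of_gcf_of_get?_eq_some hgp
  obtain ⟨ifp, hifp, hfr, hof⟩ := IntFractPair.succ_nth_stream_eq_some_iff.1 hifp'
  have hsub := sub_convs_eq hifp
  simp only [hfr, if_false] at hsub
  have hB := one_le_dens_of_irrational hα n
  have hBeq : ((GenContFract.of α).contsAux (n + 1)).b = (GenContFract.of α).dens n := by
    rw [den_eq_conts_b, nth_cont_eq_succ_nth_contAux]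
  have hpB : ((GenContFract.of α).contsAux n).b ≤ (GenContFract.of α).dens n := by
    rcases n with _ | n
    · rw [zeroth_den_eq_one]
      simp [contsAux]
    · refine le_trans (le_of_eq ?_) of_den_mono
      rw [den_eq_conts_b, nth_cont_eq_succ_nth_contAux]
  have hpB0 : 0 ≤ ((GenContFract.of α).contsAux n).b := zero_le_of_contsAux_b
  rw [hBeq] at hsub
  have hfr0 : 0 < ifp.fr := lt_of_le_of_ne (IntFractPair.nth_stream_fr_nonneg hifp) (Ne.symm hfr)
  have hinv : ifp.fr⁻¹ ≤ M + 1 := by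
    have h1 : gp.b ≤ M := hM n gp.b (partDen_eq_s_b hgp)
    have h2 := Int.lt_floor_add_one ifp.fr⁻¹
    have h3 : (ifp'.b : ℝ) = ⌊ifp.fr⁻¹⌋ := by rw [← hof]; rfl
    rw [← hb] at h1
    linarith
  have hinv0 : 0 < ifp.fr⁻¹ := inv_pos.2 hfr0
  rw [hsub, abs_div, abs_pow, abs_neg, abs_one, one_pow]
  have hpos : 0 < (GenContFract.of α).dens n *
      (ifp.fr⁻¹ * (GenContFract.of α).dens n + ((GenContFract.of α).contsAux n).b) := by
    positivity
  rw [abs_of_pos hpos]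
  refine one_div_le_one_div_of_le hpos ?_
  have : ifp.fr⁻¹ * (GenContFract.of α).dens n ≤ (M + 1) * (GenContFract.of α).dens n := by
    gcongr
  nlinarith

theorem isBadlyApproximable_iff_boundedPartialQuotients (hα : Irrational α) :
    IsBadlyApproximable α ↔ BoundedPartialQuotients α := by
  constructor
  · rintro ⟨c, hc, h⟩
    refine ⟨1 / c, fun n m hm => ?_⟩
    have hm1 : 1 ≤ m := of_one_le_get?_partDen hm
    have hB := one_le_dens_of_irrational hα n
    obtain ⟨a, b, hab⟩ := exists_int_contsAux_of α (n + 1)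
    have hnum : (GenContFract.of α).nums n = a := by
      rw [num_eq_conts_a, nth_cont_eq_succ_nth_contAux, hab]
    have hden : (GenContFract.of α).dens n = b := by
      rw [den_eq_conts_b, nth_cont_eq_succ_nth_contAux, hab]
    have hle := abs_sub_convergents_le' hm
    rw [conv_eq_num_div_den, hnum, hden] at hle
    rw [hden] at hB
    have hb1 : 1 ≤ b := by exact_mod_cast hB
    lift b to ℕ using by omega
    have hq := h b a (by omega)
    push_cast at hle hB
    have hb0 : (0 : ℝ) < b := by linarith
    have hkey : (b : ℝ) * |b * α - a| = b ^ 2 * |α - a / b| := by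
      have : (b : ℝ) * α - a = b * (α - a / b) := by field_simp
      rw [this, abs_mul, Nat.abs_cast]
      ring
    rw [hkey] at hq
    rw [le_div_iff₀ hc]
    have h1 : (b : ℝ) ^ 2 * |α - a / b| ≤ b ^ 2 * (1 / (m * b * b)) := by gcongr
    have h2 : (b : ℝ) ^ 2 * (1 / (m * b * b)) = 1 / m := by field_simp
    have h3 : c ≤ 1 / m := by linarith
    rw [le_div_iff₀ (by linarith)] at h3
    linarith
  · rintro ⟨M, hM⟩
    have hM1 : 1 ≤ M := by
      obtain ⟨gp, hgp⟩ := Option.ne_none_iff_exists'.1 (not_terminatedAt_of_irrational hα 0)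
      exact (of_one_le_get?_partDen (partDen_eq_s_b hgp)).trans (hM 0 _ (partDen_eq_s_b hgp))
    refine ⟨1 / (M + 2), by positivity, fun q p hq => ?_⟩
    have hq' : (0 : ℝ) < q := by exact_mod_cast hq
    have hkey : (q : ℝ) * |q * α - p| = q ^ 2 * |α - p / q| := by
      have : (q : ℝ) * α - p = q * (α - p / q) := by field_simp
      rw [this, abs_mul, Nat.abs_cast]
      ring
    rw [hkey]
    set r : ℚ := p / q with hr
    have hrq : ((r : ℚ) : ℝ) = p / q := by rw [hr]; push_cast; rfl
    have hden : (r.den : ℝ) ≤ q := by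
      have : (r.den : ℤ) ∣ q := by
        have := Rat.den_dvd p q
        rwa [Rat.divInt_eq_div, Int.cast_natCast] at this
      have := Int.le_of_dvd (by exact_mod_cast hq) this
      exact_mod_cast this
    have hden1 : (1 : ℝ) ≤ r.den := by exact_mod_cast r.pos
    by_cases hclose : |α - r| < 1 / (2 * (r.den : ℝ) ^ 2)
    · -- by Legendre's theorem the fraction is a convergent
      obtain ⟨n, hn⟩ := Real.exists_convs_eq_rat hclose
      have hB := one_le_dens_of_irrational hα n
      have hBq := dens_le_of_convs_eq hα hq (hn.trans hrq)
      have h1 := le_abs_sub_convs hα hM n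
      rw [hn, hrq] at h1
      calc 1 / (M + 2) = (GenContFract.of α).dens n ^ 2 *
            (1 / ((M + 2) * (GenContFract.of α).dens n ^ 2)) := by field_simp
        _ ≤ q ^ 2 * |α - p / q| := by gcongr
    · rw [hrq] at hclose
      calc 1 / (M + 2) ≤ 1 / 2 := by gcongr; linarith
        _ = (r.den : ℝ) ^ 2 * (1 / (2 * (r.den : ℝ) ^ 2)) := by field_simp
        _ ≤ q ^ 2 * |α - p / q| := by gcongr; exact not_lt.1 hclose

/-- Dirichlet's theorem yields approximations `p / q` of quality `1 / (N + 1)` with `q ≤ N`; bad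
approximability forces `q` to be of the order of `N`. -/
theorem exists_coprime_approx {c : ℝ}
    (hc : ∀ (q : ℕ) (p : ℤ), 1 ≤ q → c ≤ q * |q * α - p|) {N : ℕ} (hN : 1 ≤ N) :
    ∃ (q : ℕ) (p : ℤ), 1 ≤ q ∧ q ≤ N ∧ IsCoprime p (q : ℤ) ∧ |q * α - p| < 1 / q ∧
      c * N ≤ q := by
  obtain ⟨r, hr, hrN⟩ := Real.exists_rat_abs_sub_le_and_den_le α hN
  have hd1 : 1 ≤ r.den := r.pos
  have hd : (0 : ℝ) < r.den := by exact_mod_cast r.pos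
  have hle : |r.den * α - r.num| ≤ 1 / (N + 1) := by
    have h1 : (r.den : ℝ) * α - r.num = r.den * (α - r) := by
      have : (r.den : ℝ) * r = r.num := by exact_mod_cast Rat.den_mul_eq_num r
      linarith
    rw [h1, abs_mul, Nat.abs_cast]
    calc (r.den : ℝ) * |α - r| ≤ r.den * (1 / ((N + 1) * r.den)) := by gcongr
      _ = 1 / (N + 1) := by field_simp
  have hrN' : (r.den : ℝ) ≤ N := by exact_mod_cast hrN
  refine ⟨r.den, r.num, hd1, hrN, ?_, hle.trans_lt ?_, ?_⟩
  · rw [Int.isCoprime_iff_gcd_eq_one, Int.gcd, Int.natAbs_natCast]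
    exact r.reduced
  · gcongr
    linarith
  · have h1 := (hc r.den r.num hd1).trans (mul_le_mul_of_nonneg_left hle hd.le)
    rw [mul_one_div, le_div_iff₀ (by positivity)] at h1
    have h2 : 0 < 1 / ((N : ℝ) + 1) := by positivity
    by_cases hc0 : 0 ≤ c
    · nlinarith
    · nlinarith [Nat.cast_nonneg (α := ℝ) N]

end ContFract

end Words

namespace Words

/-! ### Linear recurrence -/

/-- If `p / q` is a reduced fraction with `|q * α - p| < 1 / q`, the discrepancies at `q`
consecutive positions are, modulo one, within `1 / q` of the translates of the multiples of
`1 / q`, so that they meet each interval of length `3 / q` in their range. -/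
theorem exists_height_sub_mem_Ioo {w : ℕ → Fin 2} {α σ τ : ℝ}
    (hσ : ∀ n : ℕ, σ ≤ height w n - n * α ∧ height w n - n * α ≤ σ + 1)
    {q : ℕ} {p : ℤ} (hq : 1 ≤ q) (hpq : IsCoprime p (q : ℤ)) (happ : |q * α - p| < 1 / q)
    (h1 : σ ≤ τ) (h2 : τ + 3 / q ≤ σ + 1) (a : ℕ) :
    ∃ i, a ≤ i ∧ i < a + q ∧ τ < height w i - i * α ∧ height w i - i * α < τ + 3 / q := by
  have hq' : (0 : ℝ) < q := by exact_mod_cast hq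
  have hqz : (0 : ℤ) < q := by exact_mod_cast hq
  obtain ⟨u, v, huv⟩ := hpq
  set r : ℤ := ⌈(τ - (height w a - a * α)) * q⌉ + 1 with hr
  -- `j * p ≡ -r` modulo `q`
  obtain ⟨j, hj⟩ := Int.eq_ofNat_of_zero_le (Int.emod_nonneg (-r * u) hqz.ne')
  have hjq : (j : ℤ) < q := hj ▸ Int.emod_lt_of_pos _ hqz
  obtain ⟨z, hz⟩ : ∃ z : ℤ, j * p = q * z - r := by
    refine ⟨r * v - (-r * u / q) * p, ?_⟩
    have := Int.emod_add_mul_ediv (-r * u) q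
    rw [hj] at this
    linear_combination p * this - r * huv
  have hjq' : (j : ℝ) < q := by exact_mod_cast hjq
  have hz' : (j : ℝ) * p = q * z - r := by exact_mod_cast hz
  -- the error of replacing `α` by `p / q`
  set θ : ℝ := j * (q * α - p) / q with hθ
  have hθ1 : |θ| < 1 / q := by
    rw [hθ, abs_div, abs_mul, Nat.abs_cast, Nat.abs_cast, div_lt_iff₀ hq']
    calc (j : ℝ) * |q * α - p| ≤ q * |q * α - p| := by gcongr
      _ < q * (1 / q) := by gcongr
      _ = 1 / q * q := by ring
  have hr1 := Int.le_ceil ((τ - (height w a - a * α)) * q)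
  have hr2 := Int.ceil_lt_add_one ((τ - (height w a - a * α)) * q)
  have hrr : (r : ℝ) = ⌈(τ - (height w a - a * α)) * q⌉ + 1 := by rw [hr]; push_cast; rfl
  have hlo : τ + 1 / q ≤ (height w a - a * α) + r / q := by
    rw [← sub_le_iff_le_add', ← sub_nonneg]
    have : (r : ℝ) / q - (τ + 1 / q - (height w a - a * α)) =
        (r - 1 - (τ - (height w a - a * α)) * q) / q := by field_simp; ring
    rw [this]
    exact div_nonneg (by linarith) hq'.le
  have hhi : (height w a - a * α) + r / q < τ + 2 / q := by
    rw [← sub_pos]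
    have : τ + 2 / q - ((height w a - a * α) + r / q) =
        (2 - r + (τ - (height w a - a * α)) * q) / q := by field_simp; ring
    rw [this]
    exact div_pos (by linarith) hq'
  set k : ℤ := height w (a + j) - height w a - z with hk
  have hD : (height w (a + j) : ℝ) - (a + j : ℕ) * α =
      (height w a - a * α) + r / q - θ + k := by
    have hkr : (k : ℝ) = height w (a + j) - height w a - z := by rw [hk]; push_cast; rfl
    have : (j : ℝ) * α = θ + (q * z - r) / q := by
      rw [← hz', hθ]
      field_simp
      ring
    rw [hkr]
    push_cast
    rw [add_mul, this]
    field_simp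
    ring
  have hθ2 := abs_lt.1 hθ1
  have e2 : (2 : ℝ) / q = 1 / q + 1 / q := by ring
  have e3 : (3 : ℝ) / q = 1 / q + 1 / q + 1 / q := by ring
  have hσj := hσ (a + j)
  rw [hD] at hσj
  have hk0 : k = 0 := by
    have hk1 : (k : ℝ) < 1 := by linarith
    have hk2 : (-1 : ℝ) < k := by linarith
    have hk1' : k < 1 := by exact_mod_cast hk1
    have hk2' : -1 < k := by exact_mod_cast hk2
    omega
  rw [hk0, Int.cast_zero, add_zero] at hD
  refine ⟨a + j, by omega, by omega, ?_, ?_⟩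
  · rw [hD]
    linarith
  · rw [hD]
    linarith

namespace IsSturmian

variable {w : ℕ → Fin 2} (hw : IsSturmian w)
include hw

/-- A window of `L` positions avoiding some factor of length `l` carries at most `l` factors of
length `l`. Some `m < l` then has as many factors of length `m` as of length `m + 1` in the window,
so that each block of length `m` determines the next letter, and the window is periodic up to its
ends. -/
theorem exists_period_of_block_ne {l L a b : ℕ} (hl : 1 ≤ l) (hL : l < L)
    (hne : ∀ i, a ≤ i → i < a + L → block w i l ≠ block w b l) :
    ∃ q, 1 ≤ q ∧ q ≤ l ∧ ∀ s, a + 2 * l ≤ s → s + l < a + L → w (s + q) = w s := by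
  classical
  set B : ℕ → Finset (List (Fin 2)) := fun m =>
    (Finset.Ico a (a + L)).image fun i => block w i m with hB
  have himage : ∀ m n, m ≤ n → (B n).image (List.take m) = B m := fun m n hmn => by
    rw [hB, Finset.image_image]
    refine Finset.image_congr fun i _ => ?_
    exact take_block w hmn
  have hmono : ∀ m n, m ≤ n → (B m).card ≤ (B n).card := fun m n hmn => by
    rw [← himage m n hmn]
    exact Finset.card_image_le
  have hBl : (B l).card ≤ l := by
    have hsub : (B l : Set (List (Fin 2))) ⊆ factorsOfLength w l \ {block w b l} := by
      intro v hv
      obtain ⟨i, hi, rfl⟩ := Finset.mem_image.1 (Finset.mem_coe.1 hv)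
      rw [Finset.mem_Ico] at hi
      exact ⟨block_mem_factorsOfLength .., hne i hi.1 hi.2⟩
    have h := Set.ncard_le_ncard hsub ((hw.finite_factorsOfLength l).subset Set.sdiff_subset)
    rw [Set.ncard_coe_finset, Set.ncard_sdiff_singleton_of_mem (block_mem_factorsOfLength w b l),
      hw l hl] at h
    omega
  obtain ⟨m, hml, hm⟩ : ∃ m < l, (B (m + 1)).card ≤ (B m).card := by
    by_contra! hgrow
    have : ∀ m ≤ l, m + 1 ≤ (B m).card := fun m => by
      induction m with
      | zero =>
        intro _
        refine Finset.card_pos.2 ⟨block w a 0, Finset.mem_image_of_mem _ ?_⟩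
        rw [Finset.mem_Ico]
        omega
      | succ m ih =>
        intro hm
        have h1 := ih (by omega)
        have h2 := hgrow m (by omega)
        omega
    have := this l le_rfl
    omega
  have hinj : Set.InjOn (List.take m) (B (m + 1) : Set (List (Fin 2))) := by
    refine Finset.injOn_of_card_image_eq (le_antisymm Finset.card_image_le ?_)
    rwa [himage m (m + 1) m.le_succ]
  have hext : ∀ i j, a ≤ i → i < a + L → a ≤ j → j < a + L → block w i m = block w j m →
      block w i (m + 1) = block w j (m + 1) := fun i j hi1 hi2 hj1 hj2 h => by
    refine hinj (Finset.mem_coe.2 (Finset.mem_image_of_mem _ (Finset.mem_Ico.2 ⟨hi1, hi2⟩)))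
      (Finset.mem_coe.2 (Finset.mem_image_of_mem _ (Finset.mem_Ico.2 ⟨hj1, hj2⟩))) ?_
    rw [take_block w m.le_succ, take_block w m.le_succ, h]
  obtain ⟨i, hi, j, hj, hij, hblock⟩ : ∃ i ∈ Finset.range (l + 1), ∃ j ∈ Finset.range (l + 1),
      i ≠ j ∧ block w (a + i) m = block w (a + j) m := by
    refine Finset.exists_ne_map_eq_of_card_lt_of_maps_to (t := B m) ?_ ?_
    · rw [Finset.card_range]
      exact Nat.lt_succ_of_le ((hmono m l hml.le).trans hBl)
    · intro i hi
      have hi' := Finset.mem_range.1 (Finset.mem_coe.1 hi)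
      exact Finset.mem_coe.2 (Finset.mem_image_of_mem _ (Finset.mem_Ico.2 ⟨by omega, by omega⟩))
  wlog hlt : i < j generalizing i j
  · exact this j hj i hi hij.symm hblock.symm (by omega)
  rw [Finset.mem_range] at hi hj
  have key : ∀ t, a + j + t < a + L →
      block w (a + i + t) (m + 1) = block w (a + j + t) (m + 1) := by
    intro t
    induction t with
    | zero =>
      intro ht
      exact hext _ _ (by omega) (by omega) (by omega) (by omega) hblock
    | succ t ih =>
      intro ht
      exact hext _ _ (by omega) (by omega) (by omega) (by omega)
        (block_add_one_eq w (ih (by omega)))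
  refine ⟨j - i, by omega, by omega, fun s hs1 hs2 => ?_⟩
  have h := ((block_succ_eq_iff w).1 (key (s - m - (a + i)) (by omega))).2
  rw [show a + i + (s - m - (a + i)) + m = s by omega,
    show a + j + (s - m - (a + i)) + m = s + (j - i) by omega] at h
  exact h.symm

variable {α : ℝ} (hα : Tendsto (fun n : ℕ => (height w n : ℝ) / n) atTop (𝓝 α))
include hα

theorem exists_bounds_height_sub :
    ∃ σ : ℝ, ∀ n : ℕ, σ ≤ height w n - n * α ∧ height w n - n * α ≤ σ + 1 := by
  have hdiff : ∀ m n : ℕ, (height w n - n * α) - 1 ≤ (height w m - m * α : ℝ) := by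
    intro m n
    rcases le_total m n with h | h
    · obtain ⟨k, rfl⟩ := Nat.exists_eq_add_of_le h
      have := abs_le.1 (hw.abs_height_sub_sub_le hα m k)
      push_cast
      linarith
    · obtain ⟨k, rfl⟩ := Nat.exists_eq_add_of_le h
      have := abs_le.1 (hw.abs_height_sub_sub_le hα n k)
      push_cast
      linarith
  refine ⟨⨅ n : ℕ, (height w n - n * α : ℝ), fun n => ⟨?_, ?_⟩⟩
  · exact ciInf_le ⟨_, Set.forall_mem_range.2 fun m => hdiff m 0⟩ n
  · linarith [le_ciInf fun m => hdiff m n]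

/-- When the slope is badly approximable, the numbers of letters `1` in the blocks of a length
`q ≤ l` are not constant over windows whose length is a fixed multiple of `l`: the discrepancy
comes so close to an end of its range that the next `q` letters must bring it back. -/
theorem exists_height_sub_ne (hbad : IsBadlyApproximable α) :
    ∃ K : ℕ, ∀ l, 1 ≤ l → ∀ q, 1 ≤ q → q ≤ l → ∀ (s : ℤ) (a : ℕ),
      ∃ i, a ≤ i ∧ i < a + K * l ∧ height w (i + q) - height w i ≠ s := by
  obtain ⟨c, hc, hbad⟩ := hbad
  obtain ⟨σ, hσ⟩ := hw.exists_bounds_height_sub hα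
  refine ⟨⌈3 / c ^ 2⌉₊, fun l hl q hq hql s a => ?_⟩
  by_contra! hconst
  have hl' : (0 : ℝ) < l := by exact_mod_cast hl
  have hq' : (0 : ℝ) < q := by exact_mod_cast hq
  have hKpos : 1 ≤ ⌈3 / c ^ 2⌉₊ := Nat.ceil_pos.2 (by positivity)
  have hN : 1 ≤ ⌈3 / c ^ 2⌉₊ * l := Nat.mul_pos hKpos hl
  set δ : ℝ := q * α - s with hδ
  have hδ1 : |δ| ≤ 1 := by
    have h := hw.abs_height_sub_sub_le hα a q
    have h' : (height w (a + q) : ℝ) - height w a = s := by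
      exact_mod_cast hconst a le_rfl (by omega)
    rwa [h', ← abs_neg, neg_sub] at h
  have hδ2 : c / l ≤ |δ| := by
    rw [div_le_iff₀ hl']
    calc c ≤ q * |δ| := hbad q s hq
      _ ≤ l * |δ| := by gcongr
      _ = |δ| * l := mul_comm _ _
  obtain ⟨d, p, hd, hdN, hcop, happ, hcd⟩ := exists_coprime_approx hbad hN
  have hd' : (0 : ℝ) < d := by exact_mod_cast hd
  have h3d : 3 / (d : ℝ) ≤ |δ| := by
    refine le_trans ?_ hδ2
    rw [div_le_div_iff₀ hd' hl']
    have h1 : 3 / c ^ 2 ≤ (⌈3 / c ^ 2⌉₊ : ℝ) := Nat.le_ceil _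
    calc 3 * (l : ℝ) = c * (c * (3 / c ^ 2 * l)) := by field_simp
      _ ≤ c * (c * (⌈3 / c ^ 2⌉₊ * l)) := by gcongr
      _ ≤ c * d := by
        push_cast at hcd
        gcongr
  have hstep : ∀ i, a ≤ i → i < a + ⌈3 / c ^ 2⌉₊ * l →
      (height w (i + q) : ℝ) - (i + q : ℕ) * α = height w i - i * α - δ := by
    intro i h1 h2
    have h' : (height w (i + q) : ℝ) - height w i = s := by exact_mod_cast hconst i h1 h2
    rw [hδ]
    push_cast
    linarith
  rcases le_total 0 δ with h0 | h0
  · rw [abs_of_nonneg h0] at *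
    obtain ⟨i, hi1, hi2, -, hi3⟩ := exists_height_sub_mem_Ioo hσ hd hcop happ le_rfl
      (by linarith) a
    have h1 := (hσ (i + q)).1
    rw [hstep i hi1 (by omega)] at h1
    linarith
  · rw [abs_of_nonpos h0] at *
    obtain ⟨i, hi1, hi2, hi3, -⟩ := exists_height_sub_mem_Ioo (τ := σ + 1 - 3 / d) hσ hd hcop happ
      (by linarith) (by linarith) a
    have h1 := (hσ (i + q)).2
    rw [hstep i hi1 (by omega)] at h1
    linarith

/-- A Sturmian word with badly approximable slope is linearly recurrent. -/
theorem exists_linear_recurrence (hbad : IsBadlyApproximable α) :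
    ∃ K : ℕ, 1 ≤ K ∧ ∀ l, 1 ≤ l → ∀ a b : ℕ,
      ∃ i, a ≤ i ∧ i < a + K * l ∧ block w i l = block w b l := by
  obtain ⟨K, hK⟩ := hw.exists_height_sub_ne hα hbad
  refine ⟨K + 3, by omega, fun l hl a b => ?_⟩
  by_contra! hne
  have hmul : (K + 3) * l = K * l + 3 * l := by ring
  rw [hmul] at hne
  obtain ⟨q, hq, hql, hper⟩ := hw.exists_period_of_block_ne hl (by omega) hne
  obtain ⟨i, hi1, hi2, hi3⟩ := hK l hl q hq hql
    (height w (a + 2 * l + q) - height w (a + 2 * l)) (a + 2 * l)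
  refine hi3 ?_
  clear hi3
  obtain ⟨t, rfl⟩ := Nat.exists_eq_add_of_le hi1
  induction t with
  | zero => rfl
  | succ t ih =>
    have h := hper (a + 2 * l + t) (by omega) (by omega)
    rw [show a + 2 * l + (t + 1) + q = a + 2 * l + t + q + 1 by omega, ← add_assoc, height_succ,
      height_succ, h, ← ih (by omega) (by omega)]
    ring

end IsSturmian

/-! ### Closed factors -/

section ClosedWords

variable {A : Type*} {w : ℕ → A}

theorem finite_setOf_infix (u : List A) : {v | v <:+: u}.Finite :=
  (List.finite_toSet u.sublists).subset fun _ hv => List.mem_sublists.2 hv.sublist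

theorem finite_closed_factors (u : List A) : {v | v <:+: u ∧ IsClosedWord v}.Finite :=
  (finite_setOf_infix u).subset fun _ hv => hv.1

theorem one_le_numClosedFactors (u : List A) : 1 ≤ numClosedFactors u :=
  (Set.ncard_pos (finite_closed_factors u)).2 ⟨[], List.nil_infix, Or.inl (by simp)⟩

theorem infix_block_iff {v : List A} {a n : ℕ} :
    v <:+: block w a n ↔ ∃ i, a ≤ i ∧ i + v.length ≤ a + n ∧ v = block w i v.length := by
  constructor
  · rintro ⟨s, t, h⟩
    have hlen := congrArg List.length h
    simp only [List.length_append, length_block] at hlen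
    refine ⟨a + s.length, by omega, by omega, ?_⟩
    rw [← take_block w (by omega : v.length ≤ n - s.length), ← drop_block, ← h]
    simp
  · rintro ⟨i, hi, hv, heq⟩
    have : v = ((block w a n).drop (i - a)).take v.length := by
      rw [drop_block, take_block w (by omega), show a + (i - a) = i by omega]
      exact heq
    rw [this]
    exact (List.take_prefix _ _).isInfix.trans (List.drop_suffix _ _).isInfix

theorem prefix_block_iff {v : List A} {a n : ℕ} :
    v <+: block w a n ↔ v.length ≤ n ∧ block w a v.length = v := by
  rw [List.prefix_iff_eq_take]
  constructor
  · intro h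
    have hlen := congrArg List.length h
    rw [List.length_take, length_block] at hlen
    have hle : v.length ≤ n := by omega
    exact ⟨hle, by rw [← take_block w hle, ← h]⟩
  · rintro ⟨h1, h2⟩
    rw [take_block w h1, h2]

theorem suffix_block_iff {v : List A} {a n : ℕ} :
    v <:+ block w a n ↔ v.length ≤ n ∧ block w (a + (n - v.length)) v.length = v := by
  rw [List.suffix_iff_eq_drop, length_block, drop_block]
  constructor
  · intro h
    have hlen := congrArg List.length h
    rw [length_block] at hlen
    have hle : v.length ≤ n := by omega
    rw [show n - (n - v.length) = v.length by omega] at h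
    exact ⟨hle, h.symm⟩
  · rintro ⟨h1, h2⟩
    rw [show n - (n - v.length) = v.length by omega, h2]

theorem isBorder_block_iff {v : List A} {a n : ℕ} :
    IsBorder v (block w a n) ↔ v.length < n ∧ block w a v.length = v ∧
      block w (a + (n - v.length)) v.length = v := by
  rw [IsBorder, prefix_block_iff, suffix_block_iff, length_block]
  exact ⟨fun h => ⟨h.1, h.2.1.2, h.2.2.2⟩, fun h => ⟨h.1, ⟨h.1.le, h.2.1⟩, h.1.le, h.2.2⟩⟩

theorem mem_occurrences_block_iff {v : List A} {a n i : ℕ} :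
    i ∈ occurrences v (block w a n) ↔ i + v.length ≤ n ∧ block w (a + i) v.length = v := by
  rw [occurrences, Set.mem_ofPred_eq, drop_block, prefix_block_iff, length_block]
  exact ⟨fun h => ⟨by omega, h.2.2⟩, fun h => ⟨by omega, by omega, h.2⟩⟩

/-- A closed word is a complete return to its longest border: the block spanned by two consecutive
occurrences of `v` is closed, and its longest border is `v`, since a longer border would contain a
third occurrence of `v`. -/
theorem isClosedWord_of_consecutive {s d l : ℕ} (hd : 1 ≤ d)
    (h : block w (s + d) l = block w s l)
    (hno : ∀ t, 1 ≤ t → t < d → block w (s + t) l ≠ block w s l) :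
    IsBorder (block w s l) (block w s (d + l)) ∧
      (∀ v, IsBorder v (block w s (d + l)) → v.length ≤ (block w s l).length) ∧
      IsClosedWord (block w s (d + l)) := by
  have hborder : IsBorder (block w s l) (block w s (d + l)) := by
    rw [isBorder_block_iff, length_block, Nat.add_sub_cancel]
    exact ⟨by omega, rfl, h⟩
  have hmax : ∀ v, IsBorder v (block w s (d + l)) → v.length ≤ (block w s l).length := by
    intro v hv
    rw [isBorder_block_iff] at hv
    rw [length_block]
    by_contra! hlong
    refine hno (d + l - v.length) (by omega) (by omega) ?_
    exact block_eq_of_le w (hv.2.2.trans hv.2.1.symm) hlong.le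
  refine ⟨hborder, hmax, Or.inr ⟨_, hborder, hmax, ?_⟩⟩
  have : occurrences (block w s l) (block w s (d + l)) = {0, d} := by
    ext i
    rw [mem_occurrences_block_iff, length_block, Set.mem_insert_iff, Set.mem_singleton_iff]
    constructor
    · rintro ⟨h1, h2⟩
      by_contra! hi
      exact hno i (by omega) (by omega) h2
    · rintro (rfl | rfl)
      · exact ⟨by omega, rfl⟩
      · exact ⟨le_rfl, h⟩
  rw [this, Set.ncard_pair (by omega)]

/-- A factor which occurs at two positions of a block is the longest border of a closed factor of
this block. -/
theorem exists_closed_factor {a n l i j : ℕ} (hai : a ≤ i) (hij : i < j) (hjn : j + l ≤ a + n)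
    (h : block w j l = block w i l) :
    ∃ z, z <:+: block w a n ∧ IsClosedWord z ∧ IsBorder (block w i l) z ∧
      ∀ v, IsBorder v z → v.length ≤ (block w i l).length := by
  classical
  have hex : ∃ d, 1 ≤ d ∧ block w (i + d) l = block w i l :=
    ⟨j - i, by omega, by rwa [show i + (j - i) = j by omega]⟩
  obtain ⟨d, ⟨hd, hdl⟩, hmin⟩ : ∃ d, (1 ≤ d ∧ block w (i + d) l = block w i l) ∧
      ∀ t, 1 ≤ t ∧ block w (i + t) l = block w i l → d ≤ t :=
    ⟨Nat.find hex, Nat.find_spec hex, fun t ht => Nat.find_min' hex ht⟩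
  have hdj : d ≤ j - i := hmin _ ⟨by omega, by rwa [show i + (j - i) = j by omega]⟩
  obtain ⟨h1, h2, h3⟩ := isClosedWord_of_consecutive hd hdl fun t ht htd hteq =>
    absurd (hmin t ⟨ht, hteq⟩) (by omega)
  refine ⟨_, ?_, h3, h1, h2⟩
  rw [infix_block_iff]
  exact ⟨i, hai, by rw [length_block]; omega, by rw [length_block]⟩

/-- A block of length `n` with period `q` has at most `q` factors of each length. -/
theorem numClosedFactors_le_of_period {a n q : ℕ} (hq : 1 ≤ q)
    (hper : ∀ i, a ≤ i → i + q < a + n → w (i + q) = w i) :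
    numClosedFactors (block w a n) ≤ q * (n + 1) := by
  classical
  have hsub : {v | v <:+: block w a n ∧ IsClosedWord v} ⊆
      ((Finset.range q ×ˢ Finset.range (n + 1)).image fun x => block w (a + x.1) x.2 :
        Finset (List A)) := by
    rintro v ⟨hv, -⟩
    obtain ⟨i, hai, hin, hvi⟩ := infix_block_iff.1 hv
    rw [hvi]
    generalize v.length = l at hin
    clear hv hvi
    obtain ⟨t, rfl⟩ := Nat.exists_eq_add_of_le hai
    induction t using Nat.strong_induction_on with
    | _ t ih =>
      rcases lt_or_ge t q with ht | ht
      · refine Finset.mem_coe.2 (Finset.mem_image.2 ⟨(t, l), ?_, rfl⟩)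
        rw [Finset.mem_product, Finset.mem_range, Finset.mem_range]
        exact ⟨ht, by simp only; omega⟩
      · have : block w (a + t) l = block w (a + (t - q)) l := by
          rw [block_eq_block_iff]
          intro k hk
          rw [show a + t + k = a + (t - q) + k + q by omega]
          exact hper _ (by omega) (by omega)
        rw [this]
        exact ih (t - q) (by omega) (by omega) (by omega)
  calc numClosedFactors (block w a n) ≤ _ := Set.ncard_le_ncard hsub (Finset.finite_toSet _)
    _ ≤ q * (n + 1) := by
      rw [Set.ncard_coe_finset]
      refine Finset.card_image_le.trans ?_
      simp

end ClosedWords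

namespace IsSturmian

variable {w : ℕ → Fin 2} (hw : IsSturmian w)
include hw

/-- If each factor of length `l ≤ m` occurs twice in a block, then each of them is the longest
border of some closed factor of the block. -/
theorem sq_le_two_mul_numClosedFactors {a n m : ℕ}
    (h : ∀ l, 1 ≤ l → l ≤ m → ∀ b, ∃ i j, a ≤ i ∧ i < j ∧ j + l ≤ a + n ∧
      block w i l = block w b l ∧ block w j l = block w b l) :
    m ^ 2 ≤ 2 * numClosedFactors (block w a n) := by
  classical
  set F : ℕ → Finset (List (Fin 2)) := fun l => (hw.finite_factorsOfLength l).toFinset with hF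
  have hFlen : ∀ l, ∀ v ∈ F l, v.length = l := by
    intro l v hv
    obtain ⟨i, rfl⟩ := (Set.Finite.mem_toFinset _).1 hv
    exact length_block w i l
  have hcard : ((Finset.Icc 1 m).biUnion F).card = ∑ l ∈ Finset.Icc 1 m, (l + 1) := by
    rw [Finset.card_biUnion]
    · refine Finset.sum_congr rfl fun l hl => ?_
      rw [hF, ← Set.ncard_eq_toFinset_card _ (hw.finite_factorsOfLength l),
        hw l (Finset.mem_Icc.1 hl).1]
    · intro l _ l' _ hne
      refine Finset.disjoint_left.2 fun v hv hv' => hne ?_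
      rw [← hFlen l v hv, hFlen l' v hv']
  have hsum : m ^ 2 ≤ 2 * ∑ l ∈ Finset.Icc 1 m, (l + 1) := by
    clear h hcard
    induction m with
    | zero => simp
    | succ m ih =>
      rw [Finset.sum_Icc_succ_top (by omega)]
      nlinarith
  have hz : ∀ v ∈ (Finset.Icc 1 m).biUnion F, ∃ z, z <:+: block w a n ∧ IsClosedWord z ∧
      IsBorder v z ∧ ∀ v', IsBorder v' z → v'.length ≤ v.length := by
    intro v hv
    obtain ⟨l, hl, hv⟩ := Finset.mem_biUnion.1 hv
    rw [Finset.mem_Icc] at hl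
    obtain ⟨b, rfl⟩ := (Set.Finite.mem_toFinset _).1 hv
    obtain ⟨i, j, hai, hij, hjn, hi, hj⟩ := h l hl.1 hl.2 b
    rw [← hi]
    exact exists_closed_factor hai hij hjn (hj.trans hi.symm)
  choose! f hf1 hf2 hf3 hf4 using hz
  have hle : ((Finset.Icc 1 m).biUnion F).card ≤ numClosedFactors (block w a n) := by
    rw [← Set.ncard_coe_finset]
    refine Set.ncard_le_ncard_of_injOn f (fun v hv => ⟨hf1 v hv, hf2 v hv⟩) ?_
      (finite_closed_factors _)
    intro v hv v' hv' heq
    have h1 := hf4 v hv v' (heq ▸ hf3 v' hv')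
    have h2 := hf4 v' hv' v (heq ▸ hf3 v hv)
    have h3 := List.prefix_of_prefix_length_le (heq ▸ (hf3 v hv).2.1) (hf3 v' hv').2.1 h2
    exact h3.eq_of_length (le_antisymm h2 h1)
  rw [hcard] at hle
  omega

variable {α : ℝ} (hα : Tendsto (fun n : ℕ => (height w n : ℝ) / n) atTop (𝓝 α))
include hα

theorem isInfiniteClosedRich_of_isBadlyApproximable (hbad : IsBadlyApproximable α) :
    IsInfiniteClosedRich w := by
  obtain ⟨K, hK, hrec⟩ := hw.exists_linear_recurrence hα hbad
  have hKr : (0 : ℝ) < K := by exact_mod_cast hK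
  refine ⟨1 / (72 * K ^ 2), by positivity, ?_⟩
  rintro n _ ⟨a, rfl⟩
  have hmain : n ^ 2 ≤ 72 * K ^ 2 * numClosedFactors (block w a n) := by
    -- factors of length at most `m` occur in both halves of a window of length `2 * K * m`
    obtain ⟨m, hm⟩ : ∃ m, m = n / (3 * K) := ⟨_, rfl⟩
    have hm1 : 3 * K * m ≤ n := by
      rw [hm]
      exact Nat.mul_div_le n (3 * K)
    have hm2 : n < 3 * K * (m + 1) := by
      rw [hm]
      exact Nat.lt_mul_div_succ n (by omega)
    rcases Nat.eq_zero_or_pos m with rfl | hm0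
    · have := one_le_numClosedFactors (block w a n)
      calc n ^ 2 ≤ (3 * K) ^ 2 := Nat.pow_le_pow_left (by omega) 2
        _ ≤ 72 * K ^ 2 * 1 := by nlinarith
        _ ≤ _ := Nat.mul_le_mul_left _ this
    · have hsq : m ^ 2 ≤ 2 * numClosedFactors (block w a n) := by
        refine hw.sq_le_two_mul_numClosedFactors fun l hl hlm b => ?_
        obtain ⟨i, hi1, hi2, hi3⟩ := hrec l hl a b
        obtain ⟨j, hj1, hj2, hj3⟩ := hrec l hl (a + K * l) b
        have h1 : K * l ≤ K * m := Nat.mul_le_mul_left K hlm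
        have h2 : 1 * l ≤ K * l := Nat.mul_le_mul_right l hK
        have h3 : 3 * K * m = 3 * (K * m) := by ring
        exact ⟨i, j, hi1, by omega, by omega, hi3, hj3⟩
      have hn : n ≤ 6 * K * m := by
        have : K * 1 ≤ K * m := Nat.mul_le_mul_left K hm0
        nlinarith
      calc n ^ 2 ≤ (6 * K * m) ^ 2 := Nat.pow_le_pow_left hn 2
        _ = 36 * K ^ 2 * m ^ 2 := by ring
        _ ≤ 36 * K ^ 2 * (2 * numClosedFactors (block w a n)) := Nat.mul_le_mul_left _ hsq
        _ = _ := by ring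
  have hmain' : (n : ℝ) ^ 2 ≤ 72 * K ^ 2 * numClosedFactors (block w a n) := by
    exact_mod_cast hmain
  rw [one_div, inv_mul_le_iff₀ (by positivity)]
  exact hmain'

/-- Very good rational approximations of the slope produce long periodic factors, which have too
few factors. -/
theorem isBadlyApproximable_of_isInfiniteClosedRich (hrich : IsInfiniteClosedRich w) :
    IsBadlyApproximable α := by
  obtain ⟨C, hC, hrich⟩ := hrich
  obtain ⟨M, hM⟩ := exists_nat_gt (2 / C)
  rw [div_lt_iff₀ hC] at hM
  refine ⟨1 / (M + 1), by positivity, fun q p hq => ?_⟩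
  by_contra! hlt
  have hq1 : (1 : ℝ) ≤ q := by exact_mod_cast hq
  have hL : ((M * q + 1 : ℕ) : ℝ) * |q * α - p| < 1 := by
    rw [lt_div_iff₀ (by positivity)] at hlt
    push_cast
    nlinarith [abs_nonneg (q * α - p)]
  obtain ⟨a, ha⟩ := hw.exists_run_height_sub_eq hα hL
  have hper : ∀ i, a ≤ i → i + q < a + (M + 1) * q → w (i + q) = w i := by
    intro i h1 h2
    rw [Nat.succ_mul] at h2
    have h3 := ha i h1 (by omega)
    have h4 := ha (i + 1) (by omega) (by omega)
    rw [show i + 1 + q = i + q + 1 by omega, height_succ, height_succ] at h4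
    have h5 : ((w (i + q) : ℕ) : ℤ) = ((w i : ℕ) : ℤ) := by omega
    apply Fin.ext
    exact_mod_cast h5
  have h1 := hrich _ _ (block_mem_factorsOfLength w a ((M + 1) * q))
  have h2 : ((numClosedFactors (block w a ((M + 1) * q)) : ℕ) : ℝ) ≤
      (q * ((M + 1) * q + 1) : ℕ) := by
    exact_mod_cast numClosedFactors_le_of_period hq hper
  have h3 := h1.trans h2
  push_cast at h3
  have hpos : (0 : ℝ) < (M + 1) * q ^ 2 := by positivity
  have h4 : ((M + 1) * (q : ℝ) ^ 2) * (C * (M + 1)) ≤ ((M + 1) * (q : ℝ) ^ 2) * 2 := by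
    have h5 : (q : ℝ) ≤ (M + 1) * q ^ 2 := by
      have : (0 : ℝ) ≤ M := Nat.cast_nonneg M
      nlinarith
    nlinarith
  have h6 := le_of_mul_le_mul_left h4 hpos
  linarith

end IsSturmian

end Words

/-- A Sturmian word has a slope, which is irrational, and the word is infinite closed-rich if and
only if the partial quotients of the continued fraction of the slope are bounded. -/
theorem mainTheorem5 (w : ℕ → Fin 2) (hw : Words.IsSturmian w) :
    ∃ α : ℝ, Words.HasSlope w α ∧ Irrational α ∧
      (Words.IsInfiniteClosedRich w ↔ Words.BoundedPartialQuotients α) := by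
  obtain ⟨α, hα⟩ := hw.exists_tendsto_height_div
  have hirr := hw.irrational_slope hα
  refine ⟨α, hα.congr fun n => ?_, hirr, ?_⟩
  · rw [← Words.count_one_block, Int.cast_natCast]
  · rw [← Words.isBadlyApproximable_iff_boundedPartialQuotients hirr]
    exact ⟨hw.isBadlyApproximable_of_isInfiniteClosedRich hα,
      hw.isInfiniteClosedRich_of_isBadlyApproximable hα⟩
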